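/- A finitely connected profinite groupoid is a groupoid $\mathfrak{G}$ in which every set $\mathsf{Hom}(a,b)$ carries a profinite (compact, Hausdorff, totally disconnected) topology such that composition and inversion are continuous, and which is equivalent, compatibly with the topologies, to a coproduct of finitely many one-object groupoids given by profinite groups. For such a $\mathfrak{G}$, let $\mathfrak{G}\text{-}\mathsf{FSets}$ denote the category of continuous functors from $\mathfrak{G}$ to the category of finite sets (those functors $X$ for which every map $\mathsf{Hom}(a,b)\to \mathsf{Hom}(X(a),X(b))$ is continuous, the finite target being discrete), with all natural transformations as morphisms. Let $F:\mathfrak{G}\to\mathfrak{H}$ be a functor between finitely connected profinite groupoids that is continuous on all $\mathsf{Hom}$-sets. Assume that the functor $\mathfrak{H}\text{-}\mathsf{FSets}\to\mathfrak{G}\text{-}\mathsf{FSets}$ given by precomposition with $F$ is an equivalence of categories. Then $F$ is an equivalence of categories, and indeed an equivalence of profinite groupoids: there is a functor $K:\mathfrak{H}\to\mathfrak{G}$, continuous on all $\mathsf{Hom}$-sets, such that $K\circ F$ and $F\circ K$ are naturally isomorphic to the respective identity functors. -/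

import Mathlib

open CategoryTheory

universe w v v₁ v₂ u u₁ u₂

/-- `G` is a groupoid each of whose hom-sets carries a topology. It is a *finitely connected
profinite groupoid* if the hom-sets are profinite spaces, composition and inversion are continuous,
and `G` is equivalent to a coproduct of finitely many one-object groupoids coming from profinite
groups. -/
structure IsFinConnProfiniteGroupoid (G : Type u) [Groupoid.{v} G]
    [∀ a b : G, TopologicalSpace (a ⟶ b)] : Prop where
  compactSpace : ∀ a b : G, CompactSpace (a ⟶ b)
  t2Space : ∀ a b : G, T2Space (a ⟶ b)
  totallyDisconnectedSpace : ∀ a b : G, TotallyDisconnectedSpace (a ⟶ b)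
  continuous_comp : ∀ a b c : G, Continuous fun p : (a ⟶ b) × (b ⟶ c) => p.1 ≫ p.2
  continuous_inv : ∀ a b : G, Continuous fun f : a ⟶ b => Groupoid.inv f
  /-- The equivalence respects the topologies: for each `i`, the map from the `i`-th profinite
  group, which is the endomorphism set of the `i`-th object of the coproduct, to the corresponding
  automorphism group of `G` is continuous (hence a homeomorphism, being a continuous bijection of
  compact Hausdorff spaces). -/
  exists_equivalence : ∃ (n : ℕ) (P : Fin n → ProfiniteGrp.{v})
    (e : (Σ i : Fin n, SingleObj (P i)) ≌ G), ∀ i : Fin n, Continuous fun g : P i =>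
      e.functor.map (Sigma.SigmaHom.mk
        (show SingleObj.star (P i) ⟶ SingleObj.star (P i) from g))

/-- A functor between groupoids with topologized hom-sets is continuous if it is continuous on all
hom-sets. -/
def IsContinuousFunctor {G : Type u₁} [Groupoid.{v₁} G] [∀ a b : G, TopologicalSpace (a ⟶ b)]
    {H : Type u₂} [Groupoid.{v₂} H] [∀ a b : H, TopologicalSpace (a ⟶ b)] (F : G ⥤ H) : Prop :=
  ∀ a b : G, Continuous fun f : a ⟶ b => F.map f

/-- A functor `X : G ⥤ FintypeCat` is a continuous action of `G` if all maps
`Hom(a, b) → Hom(X a, X b)` are continuous for the discrete topology on the (finite) target,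
that is, locally constant. -/
def isContinuousAction (G : Type u) [Groupoid.{v} G] [∀ a b : G, TopologicalSpace (a ⟶ b)] :
    ObjectProperty (G ⥤ FintypeCat.{w}) :=
  fun X => ∀ a b : G, IsLocallyConstant fun f : a ⟶ b => X.map f

/-- The category `G`-FSets of finite sets with a continuous action of `G`; the morphisms are all
natural transformations. -/
abbrev ContFSets (G : Type u) [Groupoid.{v} G] [∀ a b : G, TopologicalSpace (a ⟶ b)] :=
  (isContinuousAction.{w} G).FullSubcategory

/-- The functor `H`-FSets ⥤ `G`-FSets given by precomposition with a continuous functor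
`F : G ⥤ H`. -/
def ContFSets.pullback {G : Type u₁} [Groupoid.{v₁} G] [∀ a b : G, TopologicalSpace (a ⟶ b)]
    {H : Type u₂} [Groupoid.{v₂} H] [∀ a b : H, TopologicalSpace (a ⟶ b)]
    (F : G ⥤ H) (hF : IsContinuousFunctor F) : ContFSets.{w} H ⥤ ContFSets.{w} G :=
  (isContinuousAction.{w} G).lift
    ((isContinuousAction.{w} H).ι ⋙ (Functor.whiskeringLeft G H FintypeCat.{w}).obj F)
    (fun X a b => (X.property (F.obj a) (F.obj b)).comp_continuous (hF a b))

/-! Each property of the pullback gives one of `F`, tested on two kinds of actions: the constant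
two-point action, whose endomorphisms see connected components, and the coset actions `Hom(a, -) /
U` for open `U ≤ End a`, which see automorphism groups. Faithfulness makes `F` hit every component;
fullness keeps distinct components apart and makes `F` surjective on automorphism groups; essential
surjectivity makes it injective there. The last two rest on closed subgroups being intersections of
open ones. Compactness then makes the inverse continuous. -/

instance endTopologicalSpace {G : Type u} [Groupoid.{v} G] [∀ a b : G, TopologicalSpace (a ⟶ b)]
    (a : G) : TopologicalSpace (End a) :=
  inferInstanceAs (TopologicalSpace (a ⟶ a))

/-! ### Open subgroups and their coset actions -/

namespace IsFinConnProfiniteGroupoid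

section CosetAction

variable {G : Type u} [Groupoid.{v} G] [∀ a b : G, TopologicalSpace (a ⟶ b)]

theorem isTopologicalGroup_end (hG : IsFinConnProfiniteGroupoid G) (a : G) :
    IsTopologicalGroup (End a) where
  continuous_mul := (hG.continuous_comp a a a).comp continuous_swap
  continuous_inv := hG.continuous_inv a a

theorem continuous_comp_left (hG : IsFinConnProfiniteGroupoid G) {a b : G} (c : G) (f : a ⟶ b) :
    Continuous fun k : b ⟶ c => f ≫ k :=
  (hG.continuous_comp a b c).comp (continuous_const.prodMk continuous_id)

theorem continuous_comp_right (hG : IsFinConnProfiniteGroupoid G) (a : G) {b c : G} (k : b ⟶ c) :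
    Continuous fun f : a ⟶ b => f ≫ k :=
  (hG.continuous_comp a b c).comp (continuous_id.prodMk continuous_const)

/-- A closed subgroup of the automorphism group of an object of a profinite groupoid can be
separated from any automorphism outside of it by an open subgroup. -/
theorem exists_open_subgroup (hG : IsFinConnProfiniteGroupoid G) {a : G} (I : Subgroup (End a))
    (hI : IsClosed (I : Set (End a))) {g : End a} (hg : g ∉ I) :
    ∃ U : Subgroup (End a), IsOpen (U : Set (End a)) ∧ I ≤ U ∧ g ∉ U := by
  have := hG.isTopologicalGroup_end a
  have : CompactSpace (End a) := hG.compactSpace a a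
  have : TotallyDisconnectedSpace (End a) := hG.totallyDisconnectedSpace a a
  have key := ProfiniteGrp.closedSubgroup_eq_sInf_open (G := End a) ⟨I, hI⟩
  by_contra! hcon
  refine hg ?_
  change g ∈ (ClosedSubgroup.toSubgroup ⟨I, hI⟩)
  rw [key, Subgroup.mem_sInf]
  exact fun U hU => hcon U hU.1 hU.2

end CosetAction

end IsFinConnProfiniteGroupoid

/-- Two morphisms out of `a` are equivalent if they differ by an element of `U`. -/
def cosetSetoid {G : Type u} [Groupoid.{v} G] {a : G} (U : Subgroup (End a)) (c : G) :
    Setoid (a ⟶ c) where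
  r f g := End.of (f ≫ Groupoid.inv g) ∈ U
  iseqv :=
    { refl f := by
        rw [Groupoid.comp_inv]
        exact U.one_mem
      symm {f g} h := by
        have := U.inv_mem h
        have e : (End.of (f ≫ Groupoid.inv g))⁻¹ = End.of (g ≫ Groupoid.inv f) := by
          change Groupoid.inv (f ≫ Groupoid.inv g) = g ≫ Groupoid.inv f
          simp [Groupoid.inv_eq_inv]
        rwa [e] at this
      trans {f g k} h₁ h₂ := by
        have := U.mul_mem h₂ h₁
        have e : End.of (g ≫ Groupoid.inv k) * End.of (f ≫ Groupoid.inv g) =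
            End.of (f ≫ Groupoid.inv k) := by
          change (f ≫ Groupoid.inv g) ≫ g ≫ Groupoid.inv k = f ≫ Groupoid.inv k
          simp [Groupoid.inv_eq_inv]
        rwa [e] at this }

theorem cosetSetoid_comp {G : Type u} [Groupoid.{v} G] {a : G} (U : Subgroup (End a)) {c d : G}
    (k : c ⟶ d) {f g : a ⟶ c} (h : cosetSetoid U c f g) :
    cosetSetoid U d (f ≫ k) (g ≫ k) := by
  have e : (f ≫ k) ≫ Groupoid.inv (g ≫ k) = f ≫ Groupoid.inv g := by
    simp [Groupoid.inv_eq_inv]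
  change End.of ((f ≫ k) ≫ Groupoid.inv (g ≫ k)) ∈ U
  rw [e]
  exact h

namespace IsFinConnProfiniteGroupoid

variable {G : Type u} [Groupoid.{v} G] [∀ a b : G, TopologicalSpace (a ⟶ b)]

theorem isLocallyConstant_coset (hG : IsFinConnProfiniteGroupoid G) {a : G} (U : Subgroup (End a))
    (hU : IsOpen (U : Set (End a))) (c : G) :
    IsLocallyConstant (Quotient.mk (cosetSetoid U c)) := by
  rw [IsLocallyConstant.iff_isOpen_fiber_apply]
  intro f
  have : Quotient.mk (cosetSetoid U c) ⁻¹' {Quotient.mk (cosetSetoid U c) f} =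
      (fun g : a ⟶ c => g ≫ Groupoid.inv f) ⁻¹' (U : Set (End a)) := by
    ext g
    exact Quotient.eq (r := cosetSetoid U c)
  rw [this]
  exact hU.preimage (hG.continuous_comp_right a (Groupoid.inv f))

theorem finite_coset (hG : IsFinConnProfiniteGroupoid G) {a : G} (U : Subgroup (End a))
    (hU : IsOpen (U : Set (End a))) (c : G) : Finite (Quotient (cosetSetoid U c)) := by
  have := hG.compactSpace a c
  rw [← Set.finite_univ_iff, ← (Quotient.mk_surjective (s := cosetSetoid U c)).range_eq]
  exact (hG.isLocallyConstant_coset U hU c).range_finite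

/-- An open subgroup `U` of the automorphism group of `a` gives rise to a continuous action, which
sends `c` to the finite set `Hom(a, c) / U`. -/
theorem exists_coset_action (hG : IsFinConnProfiniteGroupoid G) {a : G} (U : Subgroup (End a))
    (hU : IsOpen (U : Set (End a))) :
    ∃ (Y : ContFSets.{w} G) (π : ∀ c, (a ⟶ c) → Y.obj.obj c),
      (∀ c, Function.Surjective (π c)) ∧
      (∀ (c d : G) (k : c ⟶ d) (f : a ⟶ c), Y.obj.map k (π c f) = π d (f ≫ k)) ∧
      (∀ (c : G) (f g : a ⟶ c), π c f = π c g ↔ End.of (f ≫ Groupoid.inv g) ∈ U) := by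
  have hfin := hG.finite_coset U hU
  have hsmall (c : G) : Small.{w} (Quotient (cosetSetoid U c)) := Countable.toSmall _
  let π (c : G) (f : a ⟶ c) : Shrink.{w} (Quotient (cosetSetoid U c)) :=
    equivShrink _ (Quotient.mk _ f)
  have hπ (c : G) : Function.Surjective (π c) :=
    (equivShrink _).surjective.comp Quotient.mk_surjective
  let m {c d : G} (k : c ⟶ d) (x : Shrink.{w} (Quotient (cosetSetoid U c))) :
      Shrink.{w} (Quotient (cosetSetoid U d)) :=
    equivShrink _ (Quotient.map (sa := cosetSetoid U c) (sb := cosetSetoid U d) (· ≫ k)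
      (fun _ _ h => cosetSetoid_comp U k h) ((equivShrink _).symm x))
  have hm {c d : G} (k : c ⟶ d) (f : a ⟶ c) : m k (π c f) = π d (f ≫ k) := by
    simp [m, π]
  let Y : G ⥤ FintypeCat.{w} :=
    { obj c := FintypeCat.of (Shrink.{w} (Quotient (cosetSetoid U c)))
      map k := FintypeCat.homMk (m k)
      map_id c := by
        refine FintypeCat.hom_ext _ _ fun x => ?_
        obtain ⟨f, rfl⟩ := hπ c x
        exact (hm _ f).trans (by rw [Category.comp_id]; rfl)
      map_comp {c d e} k l := by
        refine FintypeCat.hom_ext _ _ fun x => ?_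
        obtain ⟨f, rfl⟩ := hπ c x
        refine (hm _ f).trans ?_
        change _ = m l (m k (π c f))
        rw [hm, hm, Category.assoc] }
  refine ⟨⟨Y, fun c d => ?_⟩, π, hπ, fun c d k f => hm k f, fun c f g => ?_⟩
  · rw [IsLocallyConstant.iff_eventually_eq]
    intro k₀
    -- The set acted on is finite, so finitely many pointwise neighbourhoods can be intersected.
    have : ∀ᶠ k in nhds k₀, ∀ x, m k x = m k₀ x := by
      rw [Filter.eventually_all]
      intro x
      obtain ⟨f, rfl⟩ := hπ c x
      have hloc : IsLocallyConstant fun k : c ⟶ d => π d (f ≫ k) :=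
        ((hG.isLocallyConstant_coset U hU d).comp (equivShrink _)).comp_continuous
          (hG.continuous_comp_left d f)
      filter_upwards [hloc.eventually_eq k₀] with k hk
      rw [hm, hm, hk]
    filter_upwards [this] with k hk
    exact FintypeCat.hom_ext _ _ hk
  · exact (equivShrink _).injective.eq_iff.trans (Quotient.eq (r := cosetSetoid U c))

end IsFinConnProfiniteGroupoid

/-! ### From properties of the pullback to properties of the functor -/

namespace ContFSets

/-- The constant action on a set with two elements. -/
def two (G : Type u) [Groupoid.{v} G] [∀ a b : G, TopologicalSpace (a ⟶ b)] : ContFSets.{w} G :=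
  ⟨(Functor.const G).obj (FintypeCat.of (ULift.{w} Bool)), fun _ _ => IsLocallyConstant.const _⟩

open Classical in
/-- The endomorphism of the constant action on two elements which flips them exactly on the
connected component of `a`. -/
noncomputable def flip {G : Type u} [Groupoid.{v} G] [∀ a b : G, TopologicalSpace (a ⟶ b)]
    (a : G) : two.{w} G ⟶ two.{w} G :=
  ObjectProperty.homMk
    { app c := FintypeCat.homMk fun x : ULift.{w} Bool =>
        if Nonempty (a ⟶ c) then ULift.up (!x.down) else x
      naturality c d k := by
        have : Nonempty (a ⟶ c) ↔ Nonempty (a ⟶ d) :=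
          ⟨fun ⟨f⟩ => ⟨f ≫ k⟩, fun ⟨f⟩ => ⟨f ≫ Groupoid.inv k⟩⟩
        refine FintypeCat.hom_ext _ _ fun x => ?_
        change (if Nonempty (a ⟶ d) then ULift.up.{w} (!x.down) else x) =
          (if Nonempty (a ⟶ c) then ULift.up.{w} (!x.down) else x)
        simp only [this] }

theorem flip_app_of_nonempty {G : Type u} [Groupoid.{v} G] [∀ a b : G, TopologicalSpace (a ⟶ b)]
    {a c : G} (h : Nonempty (a ⟶ c)) (x : ULift.{w} Bool) :
    (flip.{w} a).hom.app c x = ULift.up (!x.down) :=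
  if_pos h

theorem flip_app_of_not_nonempty {G : Type u} [Groupoid.{v} G]
    [∀ a b : G, TopologicalSpace (a ⟶ b)] {a c : G} (h : ¬ Nonempty (a ⟶ c)) (x : ULift.{w} Bool) :
    (flip.{w} a).hom.app c x = x :=
  if_neg h

section Pullback

variable {G : Type u₁} [Groupoid.{v₁} G] [∀ a b : G, TopologicalSpace (a ⟶ b)]
  {H : Type u₂} [Groupoid.{v₂} H] [∀ a b : H, TopologicalSpace (a ⟶ b)]
  {F : G ⥤ H} {hF : IsContinuousFunctor F}

/-- Flipping a component that `F` misses pulls back to the identity. -/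
theorem essSurj_of_pullback_faithful (h : (pullback.{w} F hF).Faithful) : F.EssSurj where
  mem_essImage b := by
    by_contra hb
    have key : (pullback.{w} F hF).map (flip b) = (pullback.{w} F hF).map (𝟙 (two H)) := by
      apply ObjectProperty.hom_ext
      apply NatTrans.ext
      funext c
      refine FintypeCat.hom_ext _ _ fun x => ?_
      refine flip_app_of_not_nonempty (c := F.obj c) (fun ⟨f⟩ => hb ⟨c, ⟨?_⟩⟩) x
      exact ((Groupoid.isoEquivHom _ _).symm f).symm
    have hflip := (pullback.{w} F hF).map_injective key
    have h₁ := flip_app_of_nonempty.{w} (a := b) (c := b) ⟨𝟙 b⟩ ⟨true⟩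
    rw [hflip] at h₁
    exact absurd (congrArg ULift.down h₁) (by change ¬ (true = false); decide)

/-- The flip on the component of `a` lifts to `H`, where naturality along `k` forces it to act alike
at `a` and `a'`. -/
theorem nonempty_hom_of_pullback_full (h : (pullback.{w} F hF).Full) {a a' : G}
    (k : F.obj a ⟶ F.obj a') : Nonempty (a ⟶ a') := by
  by_contra ha
  obtain ⟨τ, hτ⟩ := (pullback.{w} F hF).map_surjective (X := two H) (Y := two H)
    (show (pullback.{w} F hF).obj (two H) ⟶ (pullback.{w} F hF).obj (two H) from flip a)
  have app (c : G) (x : ULift.{w} Bool) :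
      τ.hom.app (F.obj c) x = (flip.{w} a).hom.app c x := by
    have happ : τ.hom.app (F.obj c) = (flip.{w} a).hom.app c :=
      congrArg (fun t => t.hom.app c) hτ
    rw [happ]
    rfl
  have nat : τ.hom.app (F.obj a') (ULift.up.{w} true) = τ.hom.app (F.obj a) (ULift.up.{w} true) :=
    ConcreteCategory.congr_hom (τ.hom.naturality k) (ULift.up.{w} true)
  rw [app, app, flip_app_of_nonempty ⟨𝟙 a⟩, flip_app_of_not_nonempty ha] at nat
  exact absurd (congrArg ULift.down nat) (by decide)

/-- The automorphism `g` acts trivially on every pulled-back action, but nontrivially on `Hom(a, -)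
/ U` if `U` is open and omits `g`. -/
theorem eq_id_of_pullback_essSurj (hG : IsFinConnProfiniteGroupoid G)
    (h : (pullback.{w} F hF).EssSurj) {a : G} (g : a ⟶ a) (hg : F.map g = 𝟙 _) : g = 𝟙 a := by
  by_contra hne
  have : T2Space (End a) := hG.t2Space a a
  obtain ⟨U, hU, -, hgU⟩ := hG.exists_open_subgroup (⊥ : Subgroup (End a))
    (by rw [Subgroup.coe_bot]; exact isClosed_singleton) (g := g)
    (fun hbot => hne (Subgroup.mem_bot.mp hbot))
  obtain ⟨Y, π, -, hmap, hπ⟩ := hG.exists_coset_action.{w} U hU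
  obtain ⟨Z, ⟨e⟩⟩ := h.mem_essImage Y
  have hYg : Y.obj.map g = 𝟙 _ := by
    have nat := e.hom.hom.naturality g
    have hZ : ((pullback.{w} F hF).obj Z).obj.map g = 𝟙 _ := by
      change Z.obj.map (F.map g) = _
      rw [hg]
      exact Z.obj.map_id _
    rw [hZ, Category.id_comp] at nat
    have he : e.inv.hom.app a ≫ e.hom.hom.app a = 𝟙 _ :=
      congrArg (fun t => t.hom.app a) e.inv_hom_id
    calc Y.obj.map g = (e.inv.hom.app a ≫ e.hom.hom.app a) ≫ Y.obj.map g := by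
          rw [he, Category.id_comp]
      _ = 𝟙 _ := by rw [Category.assoc, ← nat, he]
  have h₁ := hmap a a g (𝟙 a)
  rw [hYg, Category.id_comp] at h₁
  have h₂ := (hπ a g (𝟙 a)).mp h₁.symm
  have e' : g ≫ Groupoid.inv (𝟙 a) = g := by simp [Groupoid.inv_eq_inv]
  rw [e'] at h₂
  exact hgU h₂

theorem exists_map_eq_of_pullback_full (hG : IsFinConnProfiniteGroupoid G)
    (hH : IsFinConnProfiniteGroupoid H) (h : (pullback.{w} F hF).Full) {a : G}
    (k : F.obj a ⟶ F.obj a) : ∃ g : a ⟶ a, F.map g = k := by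
  by_contra hk
  have : CompactSpace (End a) := hG.compactSpace a a
  have : T2Space (End (F.obj a)) := hH.t2Space _ _
  let φ : End a →* End (F.obj a) :=
    { toFun g := F.map g
      map_one' := F.map_id a
      map_mul' x y := F.map_comp y x }
  have hφ : Continuous φ := hF a a
  obtain ⟨U, hU, hIU, hkU⟩ := hH.exists_open_subgroup φ.range
    (by rw [MonoidHom.coe_range]; exact (isCompact_range hφ).isClosed) (g := k)
    (fun ⟨g, hg⟩ => hk ⟨g, hg⟩)
  -- With `U = ⊤`, `Z` has one point over the component of `F.obj a` and is empty elsewhere.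
  obtain ⟨Z, ρ, hρ, hZmap, hρ'⟩ :=
    hH.exists_coset_action.{w} (⊤ : Subgroup (End (F.obj a))) isOpen_univ
  obtain ⟨Y, π, -, hYmap, hπ⟩ := hH.exists_coset_action.{w} U hU
  have ne {c : G} (x : Z.obj.obj (F.obj c)) : Nonempty (a ⟶ c) :=
    nonempty_hom_of_pullback_full h (hρ _ x).choose
  have indep {c : G} (f g : a ⟶ c) : π _ (F.map f) = π _ (F.map g) := by
    refine (hπ _ _ _).mpr (hIU ⟨f ≫ Groupoid.inv g, ?_⟩)
    change F.map (f ≫ Groupoid.inv g) = F.map f ≫ Groupoid.inv (F.map g)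
    simp [Groupoid.inv_eq_inv]
  -- The base coset is fixed by the image of `End a`, so it spreads to a map over `G`. A lift to `H`
  -- would make `k` fix it too, that is, `k ∈ U`.
  let σ : (pullback.{w} F hF).obj Z ⟶ (pullback.{w} F hF).obj Y := ObjectProperty.homMk
    { app c := FintypeCat.homMk fun x : Z.obj.obj (F.obj c) => π _ (F.map (ne x).some)
      naturality c d l := by
        refine FintypeCat.hom_ext _ _ fun x => ?_
        change π _ (F.map (ne (Z.obj.map (F.map l) x)).some) =
          Y.obj.map (F.map l) (π _ (F.map (ne x).some))
        rw [hYmap, ← F.map_comp]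
        exact indep _ _ }
  obtain ⟨τ, hτ⟩ := (pullback.{w} F hF).map_surjective σ
  have hτa (x : Z.obj.obj (F.obj a)) : τ.hom.app (F.obj a) x = π _ (𝟙 _) := by
    have h₁ : τ.hom.app (F.obj a) x = π _ (F.map (ne x).some) :=
      ConcreteCategory.congr_hom (congrArg (fun t => t.hom.app a) hτ) x
    rw [h₁, ← F.map_id]
    exact indep _ _
  have nat : τ.hom.app (F.obj a) (Z.obj.map k (ρ _ (𝟙 _))) =
      Y.obj.map k (τ.hom.app (F.obj a) (ρ _ (𝟙 _))) :=
    ConcreteCategory.congr_hom (τ.hom.naturality k) (ρ _ (𝟙 _))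
  rw [hτa, hτa, hYmap, Category.id_comp] at nat
  have h₂ := (hπ _ k (𝟙 _)).mp nat.symm
  have e : k ≫ Groupoid.inv (𝟙 (F.obj a)) = k := by simp [Groupoid.inv_eq_inv]
  rw [e] at h₂
  exact hkU h₂

theorem faithful_of_pullback_essSurj (hG : IsFinConnProfiniteGroupoid G)
    (h : (pullback.{w} F hF).EssSurj) : F.Faithful where
  map_injective {a b} f g hfg := by
    have h₁ := eq_id_of_pullback_essSurj hG h (f ≫ Groupoid.inv g) (by
      rw [F.map_comp, hfg, ← F.map_comp, Groupoid.comp_inv, F.map_id])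
    calc f = (f ≫ Groupoid.inv g) ≫ g := by simp
      _ = g := by rw [h₁, Category.id_comp]

theorem full_of_pullback_full (hG : IsFinConnProfiniteGroupoid G)
    (hH : IsFinConnProfiniteGroupoid H) (h : (pullback.{w} F hF).Full) : F.Full where
  map_surjective {a b} k := by
    obtain ⟨f⟩ := nonempty_hom_of_pullback_full h k
    obtain ⟨g, hg⟩ := exists_map_eq_of_pullback_full hG hH h (k ≫ Groupoid.inv (F.map f))
    exact ⟨g ≫ f, by rw [F.map_comp, hg]; simp⟩

end Pullback

end ContFSets

/-- A quasi-inverse of a continuous equivalence of profinite groupoids is continuous. -/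
theorem IsContinuousFunctor.inv {G : Type u₁} [Groupoid.{v₁} G]
    [∀ a b : G, TopologicalSpace (a ⟶ b)] {H : Type u₂} [Groupoid.{v₂} H]
    [∀ a b : H, TopologicalSpace (a ⟶ b)] (hG : IsFinConnProfiniteGroupoid G)
    (hH : IsFinConnProfiniteGroupoid H) {F : G ⥤ H} (hF : IsContinuousFunctor F)
    [F.IsEquivalence] : IsContinuousFunctor F.inv := by
  intro a b
  have := hG.compactSpace (F.inv.obj a) (F.inv.obj b)
  have := hH.t2Space (F.obj (F.inv.obj a)) (F.obj (F.inv.obj b))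
  -- An injective continuous map from a compact to a Hausdorff space is a closed embedding, so
  -- continuity can be tested after applying `F`.
  have hemb := (hF (F.inv.obj a) (F.inv.obj b)).isClosedEmbedding F.map_injective
  rw [hemb.isInducing.continuous_iff]
  let ε : F.inv ⋙ F ≅ 𝟭 H := F.asEquivalence.counitIso
  let p (c : H) : F.obj (F.inv.obj c) ⟶ c := ε.hom.app c
  let q (c : H) : c ⟶ F.obj (F.inv.obj c) := ε.inv.app c
  have : (fun f : F.inv.obj a ⟶ F.inv.obj b => F.map f) ∘ (fun f : a ⟶ b => F.inv.map f) =
      fun f => p a ≫ f ≫ q b := by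
    funext f
    have nat : F.map (F.inv.map f) ≫ p b = p a ≫ f := ε.hom.naturality f
    have hpq : p b ≫ q b = 𝟙 _ := ε.hom_inv_id_app b
    change F.map (F.inv.map f) = _
    rw [← Category.assoc, ← nat, Category.assoc, hpq, Category.comp_id]
  rw [this]
  exact (hH.continuous_comp_left _ _).comp (hH.continuous_comp_right _ _)

theorem mainTheorem6 {G : Type u₁} [Groupoid.{v₁} G] [∀ a b : G, TopologicalSpace (a ⟶ b)]
    {H : Type u₂} [Groupoid.{v₂} H] [∀ a b : H, TopologicalSpace (a ⟶ b)]
    (hG : IsFinConnProfiniteGroupoid G) (hH : IsFinConnProfiniteGroupoid H)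
    (F : G ⥤ H) (hF : IsContinuousFunctor F)
    (h : (ContFSets.pullback.{w} F hF).IsEquivalence) :
    F.IsEquivalence ∧
      ∃ K : H ⥤ G, IsContinuousFunctor K ∧ Nonempty (F ⋙ K ≅ 𝟭 G) ∧ Nonempty (K ⋙ F ≅ 𝟭 H) := by
  have := ContFSets.essSurj_of_pullback_faithful (hF := hF) h.faithful
  have := ContFSets.faithful_of_pullback_essSurj hG (hF := hF) h.essSurj
  have := ContFSets.full_of_pullback_full hG hH (hF := hF) h.full
  have hE : F.IsEquivalence := {}
  exact ⟨hE, F.inv, hF.inv hG hH, ⟨F.asEquivalence.unitIso.symm⟩, ⟨F.asEquivalence.counitIso⟩⟩
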